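/- Let $N>2$, $n\ge 1$ and $1\le m\le n$ be integers, let $g:\mathbb R\times\mathbb R\to\mathbb R$ be continuous, and let $a_0(t),\dots,a_{n-1}(t)$ ($t=0,\dots,N-1$) and $b_{ij}(k)$ ($1\le i,j\le n$, $k=0,\dots,N$) be real numbers with $a_0(t)\ne 0$ for all $t$. Consider the boundary value problem $$y(t+n)+a_{n-1}(t)y(t+n-1)+\cdots+a_0(t)y(t)=g(t,y(t+m-1)),\qquad t=0,\dots,N-1,\tag{1}$$ $$\sum_{k=0}^{N}\sum_{j=1}^n b_{ij}(k)\,y(j+k-1)=0,\qquad i=1,\dots,n.\tag{2}$$ Notation. Let $B_k=(b_{ij}(k))_{i,j}\in\mathbb R^{n\times n}$; let $A(t)$ be the companion matrix with last row $(-a_0(t),\dots,-a_{n-1}(t))$, ones on the superdiagonal and zeros elsewhere (so that (1) is a first-order system for $x(t)=(y(t),\dots,y(t+n-1))^T$); let $\Phi(0)=I$, $\Phi(t)=A(t-1)\cdots A(0)$, and $M=\sum_{i=0}^N B_i\Phi(i)$. Let $X=\{\phi:\{0,\dots,N\}\to\mathbb R^n \mid \sum_{i=0}^N B_i\phi(i)=0\}$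 and $Z=\{\phi:\{0,\dots,N-1\}\to\mathbb R^n\}$, both with the norm $\|\phi\|=\max_t|\phi(t)|$, where $|\cdot|$ is the Euclidean norm, and let $\mathcal L:X\to Z$, $(\mathcal Lx)(t)=x(t+1)-A(t)x(t)$. Assume that the boundary conditions are independent, i.e. the $n\times n(N+1)$ matrix $[B_0,\dots,B_N]$ has rank $n$, and that the solution space $\ker\mathcal L$ of the linear homogeneous problem is one-dimensional. Then $\ker M$ and $\ker M^T$ are one-dimensional; let $u$ and $w$ be basis vectors of $\ker M$ and $\ker M^T$, and put $$S(t)=\Phi(t)u,\qquad \Psi(t)^T=\sum_{i=t+1}^N w^TB_i\Phi(i)\Phi(t+1)^{-1}\quad(0\le t\le N-1).$$ Let $V$ be the orthogonal projection of $\mathbb R^n$ onto $\ker M$ and define $P:X\to X$ and $Q:Z\to Z$ by $$(Px)(t)=\Phi(t)Vx(0),\qquad (Qh)(t)=\Psi(t)\Big(\sum_{j=0}^{N-1}|\Psi(j)|^2\Big)^{-1}\sum_{i=0}^{N-1}\Psi(i)^Th(i).$$ Then $P$ and $I-Q$ are projections onto $\ker\mathcal L$ and $\operatorname{Im}\mathcal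 L$. Let $M_p:\operatorname{Im}\mathcal L\to\ker P$ be the inverse of $\mathcal L|_{\ker P}$, and let $A=\|M_p(I-Q)\|$ be the operator norm of $M_p(I-Q):Z\to X$. Write $[v]_k$ for the $k$-th coordinate of $v\in\mathbb R^n$. For signs $\sigma,\tau\in\{+,-\}$ let $\mathcal O_{\sigma\tau}$ be the set of $t\in\{0,\dots,N-1\}$ such that $[\Psi(t)]_n\neq0$ has sign $\sigma$ and $[S(t)]_m\neq 0$ has sign $\tau$; let $\mathcal O$ be the union of these four sets, assumed nonempty, and let $\mathcal O_0=\{t\in\{0,\dots,N-1\} \mid [\Psi(t)]_n\ne0,\ [S(t)]_m=0\}$. Put $s_{\max}=\max_{0\le t\le N-1}|[S(t)]_m|$ and $s_{\min}=\min_{t\in\mathcal O}|[S(t)]_m|$. Suppose that: 1. $\mathcal O_0=\emptyset$. 2. There are $0<c<d$ and real functions $W_1,U_1,W_2,U_2,w_1,u_1,w_2,u_2$ of $t$ such that for all $x\in[c,d]$: $W_1(t)<g(t,x)$ on $\mathcal O_{++}$, $g(t,x)<u_1(t)$ on $\mathcal O_{+-}$, $g(t,x)<W_2(t)$ on $\mathcal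 O_{-+}$, $u_2(t)<g(t,x)$ on $\mathcal O_{--}$; and for all $x\in[-d,-c]$: $g(t,x)<U_1(t)$ on $\mathcal O_{++}$, $w_1(t)<g(t,x)$ on $\mathcal O_{+-}$, $U_2(t)<g(t,x)$ on $\mathcal O_{-+}$, $g(t,x)<w_2(t)$ on $\mathcal O_{--}$. 3. $J_2\le 0\le J_1$, where $$J_1=\sum_{\mathcal O_{++}}[\Psi(i)]_nW_1(i)+\sum_{\mathcal O_{+-}}[\Psi(i)]_nw_1(i)+\sum_{\mathcal O_{-+}}[\Psi(i)]_nW_2(i)+\sum_{\mathcal O_{--}}[\Psi(i)]_nw_2(i),$$ $$J_2=\sum_{\mathcal O_{++}}[\Psi(i)]_nU_1(i)+\sum_{\mathcal O_{+-}}[\Psi(i)]_nu_1(i)+\sum_{\mathcal O_{-+}}[\Psi(i)]_nU_2(i)+\sum_{\mathcal O_{--}}[\Psi(i)]_nu_2(i).$$ 4. There are $M_1,M_2>0$ and $0<\beta\le1$ with $|g(t,x)|\le M_1|x|^\beta+M_2$ for all $x\in[-d,d]$ and $t=0,\dots,N-1$. 5. With $K_1=AM_1$ and $K_2=AM_2$,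 $\ s_{\min}-K_1\beta(s_{\max}+s_{\min})>0$ and $$d>\frac{c\,s_{\max}+(K_1(1-\beta)+K_2)(s_{\max}+s_{\min})}{s_{\min}-K_1\beta(s_{\max}+s_{\min})}.$$ Then the boundary value problem (1)–(2) has at least one solution. -/

import Mathlib

open scoped Matrix

noncomputable section

namespace MultipointBVP

/-! Throughout, `n ≥ 1` is the order of the equation and `0, …, N` are the times of the first-order
system.  The coefficient `a_j(t)` is `a t j` for `j : Fin n`, the boundary coefficient `b_{ij}(k)`,
`1 ≤ i, j ≤ n`, is the entry of `B k` at the zero-based indices `i - 1, j - 1 : Fin n`, and every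
coordinate of a vector of `ℝⁿ` is indexed by `Fin n` from `0` in the same way. -/

/-- The index of the last (`n`-th) coordinate of a vector of `ℝⁿ`. -/
def lastIdx (n : ℕ) [NeZero n] : Fin n := ⟨n - 1, Nat.sub_lt (NeZero.pos n) Nat.one_pos⟩

/-- The scalar nonlinear boundary value problem: `y` satisfies
`y(t+n) + a_{n-1}(t) y(t+n-1) + ⋯ + a_0(t) y(t) = g(t, y(t+m))` for `t = 0, …, N-1` and
`∑_{k=0}^{N} ∑_j b_{ij}(k) y(k+j) = 0` for all `i` (zero-based `i`, `j` and `m`).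
Only the values `y(0), …, y(N+n-1)` are involved. -/
def IsSolution {n : ℕ} (N : ℕ) (a : ℕ → Fin n → ℝ) (B : ℕ → Matrix (Fin n) (Fin n) ℝ)
    (m : Fin n) (g : ℝ → ℝ → ℝ) (y : ℕ → ℝ) : Prop :=
  (∀ t < N, y (t + n) + ∑ j : Fin n, a t j * y (t + j) = g t (y (t + m))) ∧
  ∀ i : Fin n, ∑ k ∈ Finset.range (N + 1), ∑ j : Fin n, B k i j * y (k + j) = 0

/-- The boundary conditions are independent: the augmented `n × (N+1)n` matrix `[B_0, …, B_N]`
has linearly independent rows. -/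
def IndependentBC {n : ℕ} (N : ℕ) (B : ℕ → Matrix (Fin n) (Fin n) ℝ) : Prop :=
  LinearIndependent ℝ fun (i : Fin n) (p : Fin (N + 1) × Fin n) => B p.1 i p.2

/-- The companion matrix `A(t)`. -/
def companion {n : ℕ} (a : ℕ → Fin n → ℝ) (t : ℕ) : Matrix (Fin n) (Fin n) ℝ :=
  Matrix.of fun i j =>
    if (i : ℕ) + 1 = n then -a t j else if (j : ℕ) = i + 1 then 1 else 0

/-- The fundamental matrix `Φ(t) = A(t-1) ⋯ A(0)`. -/
def fundMat {n : ℕ} (a : ℕ → Fin n → ℝ) : ℕ → Matrix (Fin n) (Fin n) ℝ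
  | 0 => 1
  | t + 1 => companion a t * fundMat a t

/-- The matrix `∑_{i=0}^N B_i Φ(i)`. -/
def bdryMat {n : ℕ} (N : ℕ) (a : ℕ → Fin n → ℝ) (B : ℕ → Matrix (Fin n) (Fin n) ℝ) :
    Matrix (Fin n) (Fin n) ℝ :=
  ∑ i ∈ Finset.range (N + 1), B i * fundMat a i

/-- The kernel in `ℝⁿ` of a square matrix. -/
abbrev matKer {n : ℕ} (C : Matrix (Fin n) (Fin n) ℝ) : Submodule ℝ (EuclideanSpace ℝ (Fin n)) :=
  LinearMap.ker (Matrix.toEuclideanLin C)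

/-- The space `X` of maps `φ : {0, …, N} → ℝⁿ` with `∑_{i=0}^N B_i φ(i) = 0`; its norm is the
supremum over time of the Euclidean norm. -/
def spaceX {n : ℕ} (N : ℕ) (B : ℕ → Matrix (Fin n) (Fin n) ℝ) :
    Submodule ℝ (Fin (N + 1) → EuclideanSpace ℝ (Fin n)) where
  carrier := {φ | ∑ i : Fin (N + 1), Matrix.toEuclideanLin (B i) (φ i) = 0}
  add_mem' {φ ψ} hφ hψ := by
    simp only [Set.mem_ofPred_eq, Pi.add_apply, map_add, Finset.sum_add_distrib] at hφ hψ ⊢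
    rw [hφ, hψ, add_zero]
  zero_mem' := by simp
  smul_mem' c φ hφ := by
    simp only [Set.mem_ofPred_eq, Pi.smul_apply, map_smul, ← Finset.smul_sum] at hφ ⊢
    rw [hφ, smul_zero]

/-- The space `Z` of maps `{0, …, N-1} → ℝⁿ`, with the supremum over time of the Euclidean norm. -/
abbrev spaceZ (n N : ℕ) : Type := Fin N → EuclideanSpace ℝ (Fin n)

/-- The operator `ℒ : X → Z`, `(ℒ x)(t) = x(t+1) - A(t) x(t)`. -/
def opL {n : ℕ} (N : ℕ) (a : ℕ → Fin n → ℝ) (B : ℕ → Matrix (Fin n) (Fin n) ℝ) :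
    spaceX N B →ₗ[ℝ] spaceZ n N where
  toFun x t := x.1 t.succ - Matrix.toEuclideanLin (companion a t) (x.1 t.castSucc)
  map_add' x y := by
    ext1 t
    simp only [Submodule.coe_add, Pi.add_apply, map_add]
    abel
  map_smul' c x := by
    ext1 t
    simp only [Submodule.coe_smul, Pi.smul_apply, map_smul, smul_sub, RingHom.id_apply]

/-- The solution space of the linear homogeneous problem `x(t+1) = A(t) x(t)`,
`∑_{i=0}^N B_i x(i) = 0`, is one-dimensional. -/
def Resonant {n : ℕ} (N : ℕ) (a : ℕ → Fin n → ℝ) (B : ℕ → Matrix (Fin n) (Fin n) ℝ) : Prop :=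
  Module.finrank ℝ (LinearMap.ker (opL N a B)) = 1

/-- The vector `u` forms a basis of the one-dimensional subspace `U`. -/
def IsBasisVector {n : ℕ} (U : Submodule ℝ (EuclideanSpace ℝ (Fin n)))
    (u : EuclideanSpace ℝ (Fin n)) : Prop :=
  u ≠ 0 ∧ Submodule.span ℝ {u} = U

/-- `S(t) = Φ(t) u`. -/
def solS {n : ℕ} (a : ℕ → Fin n → ℝ) (u : EuclideanSpace ℝ (Fin n)) (t : ℕ) :
    EuclideanSpace ℝ (Fin n) :=
  Matrix.toEuclideanLin (fundMat a t) u

/-- `Ψ(t)`, the transpose of the row vector `∑_{i=t+1}^N wᵀ B_i Φ(i) Φ(t+1)⁻¹`. -/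
def adjPsi {n : ℕ} (N : ℕ) (a : ℕ → Fin n → ℝ) (B : ℕ → Matrix (Fin n) (Fin n) ℝ)
    (w : EuclideanSpace ℝ (Fin n)) (t : ℕ) : EuclideanSpace ℝ (Fin n) :=
  ∑ i ∈ Finset.Icc (t + 1) N,
    Matrix.toEuclideanLin (B i * fundMat a i * (fundMat a (t + 1))⁻¹)ᵀ w

/-- `t ↦ Φ(t) v` satisfies the boundary conditions if `v` lies in the kernel of
`∑_{i=0}^N B_i Φ(i)`. -/
theorem fundMat_mem_spaceX {n N : ℕ} {a : ℕ → Fin n → ℝ} {B : ℕ → Matrix (Fin n) (Fin n) ℝ}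
    {v : EuclideanSpace ℝ (Fin n)} (hv : v ∈ matKer (bdryMat N a B)) :
    (fun t : Fin (N + 1) => Matrix.toEuclideanLin (fundMat a t) v) ∈ spaceX N B := by
  rw [LinearMap.mem_ker] at hv
  change ∑ i : Fin (N + 1), _ = _
  rw [← hv, bdryMat, Finset.sum_range, map_sum, LinearMap.sum_apply]
  refine Finset.sum_congr rfl fun i _ => ?_
  simp [Matrix.toLpLin_apply, Matrix.mulVec_mulVec]

/-- The projection `P : X → X`, `(P x)(t) = Φ(t) V x(0)`, where `V` is the orthogonal projection of
`ℝⁿ` onto the kernel of `∑_{i=0}^N B_i Φ(i)`. -/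
def projP {n : ℕ} (N : ℕ) (a : ℕ → Fin n → ℝ) (B : ℕ → Matrix (Fin n) (Fin n) ℝ) :
    spaceX N B →ₗ[ℝ] spaceX N B where
  toFun x :=
    ⟨fun t => Matrix.toEuclideanLin (fundMat a t)
      ((matKer (bdryMat N a B)).starProjection (x.1 0)),
      fundMat_mem_spaceX (Submodule.starProjection_apply_mem _ (x.1 0))⟩
  map_add' x y := by
    ext1
    funext t
    simp only [Submodule.coe_add, Pi.add_apply, map_add]
  map_smul' c x := by
    ext1
    funext t
    simp only [Submodule.coe_smul, Pi.smul_apply, map_smul, RingHom.id_apply]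

/-- The projection `Q : Z → Z`,
`(Q h)(t) = Ψ(t) (∑_{j=0}^{N-1} |Ψ(j)|²)⁻¹ ∑_{i=0}^{N-1} Ψ(i)ᵀ h(i)`. -/
def projQ {n : ℕ} (N : ℕ) (a : ℕ → Fin n → ℝ) (B : ℕ → Matrix (Fin n) (Fin n) ℝ)
    (w : EuclideanSpace ℝ (Fin n)) : spaceZ n N →ₗ[ℝ] spaceZ n N where
  toFun h t := ((∑ j : Fin N, ‖adjPsi N a B w j‖ ^ 2)⁻¹ *
    ∑ i : Fin N, inner ℝ (adjPsi N a B w i) (h i)) • adjPsi N a B w t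
  map_add' h k := by
    ext1 t
    simp only [Pi.add_apply, inner_add_right, Finset.sum_add_distrib, mul_add, add_smul]
  map_smul' c h := by
    ext1 t
    simp only [Pi.smul_apply, inner_smul_right, ← Finset.mul_sum, RingHom.id_apply, smul_smul]
    congr 1
    ring

/-- The restriction of `ℒ` to `Ker P`. -/
def opLKerP {n : ℕ} (N : ℕ) (a : ℕ → Fin n → ℝ) (B : ℕ → Matrix (Fin n) (Fin n) ℝ) :
    LinearMap.ker (projP N a B) →ₗ[ℝ] spaceZ n N :=
  (opL N a B).domRestrict (LinearMap.ker (projP N a B))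

/-- The operator `M_p (I - Q) : Z → X`, where `M_p : Im ℒ → Ker P` is the inverse of the
restriction of `ℒ` to `Ker P`.  (Here `M_p` is first extended linearly to all of `Z` as a left
inverse of the injective map `ℒ|_{Ker P}`; the extension plays no role, since `I - Q` has
range `Im ℒ`.) -/
def opMpIQ {n : ℕ} (N : ℕ) (a : ℕ → Fin n → ℝ) (B : ℕ → Matrix (Fin n) (Fin n) ℝ)
    (w : EuclideanSpace ℝ (Fin n)) : spaceZ n N →L[ℝ] spaceX N B :=
  LinearMap.toContinuousLinearMap
    ((LinearMap.ker (projP N a B)).subtype ∘ₗ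
      LinearMap.leftInverse (K := ℝ) (V := LinearMap.ker (projP N a B)) (V' := spaceZ n N)
        (opLKerP N a B) ∘ₗ
      (LinearMap.id - projQ N a B w))

section SignSets

variable {n : ℕ} [NeZero n] (N : ℕ) (a : ℕ → Fin n → ℝ) (B : ℕ → Matrix (Fin n) (Fin n) ℝ)
  (m : Fin n) (u w : EuclideanSpace ℝ (Fin n))

/-- The last coordinate `[Ψ(t)]_n`. -/
def psiLast (t : ℕ) : ℝ := adjPsi N a B w t (lastIdx n)

/-- `𝒪₊₊ = {t ∈ {0, …, N-1} | [Ψ(t)]_n > 0, [S(t)]_m > 0}`. -/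
def setPP : Set ℕ := {t | t < N ∧ 0 < psiLast N a B w t ∧ 0 < solS a u t m}

/-- `𝒪₊₋ = {t ∈ {0, …, N-1} | [Ψ(t)]_n > 0, [S(t)]_m < 0}`. -/
def setPM : Set ℕ := {t | t < N ∧ 0 < psiLast N a B w t ∧ solS a u t m < 0}

/-- `𝒪₋₊ = {t ∈ {0, …, N-1} | [Ψ(t)]_n < 0, [S(t)]_m > 0}`. -/
def setMP : Set ℕ := {t | t < N ∧ psiLast N a B w t < 0 ∧ 0 < solS a u t m}

/-- `𝒪₋₋ = {t ∈ {0, …, N-1} | [Ψ(t)]_n < 0, [S(t)]_m < 0}`. -/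
def setMM : Set ℕ := {t | t < N ∧ psiLast N a B w t < 0 ∧ solS a u t m < 0}

/-- `𝒪₀ = {t ∈ {0, …, N-1} | [Ψ(t)]_n ≠ 0, [S(t)]_m = 0}`. -/
def setZero : Set ℕ := {t | t < N ∧ psiLast N a B w t ≠ 0 ∧ solS a u t m = 0}

/-- `𝒪 = 𝒪₊₊ ∪ 𝒪₊₋ ∪ 𝒪₋₊ ∪ 𝒪₋₋`. -/
def setO : Set ℕ :=
  setPP N a B m u w ∪ setPM N a B m u w ∪ setMP N a B m u w ∪ setMM N a B m u w

/-- `s_max = max_{0 ≤ t ≤ N-1} |[S(t)]_m|`. -/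
def sMax : ℝ := ⨆ t : Fin N, |solS a u t m|

/-- `s_min = min_{t ∈ 𝒪} |[S(t)]_m|`, a minimum over a finite set, for `𝒪` nonempty.  (For `𝒪` empty
the value is `0`, so that `s_min - K β (s_max + s_min) > 0` fails for all `K ≥ 0`, `β > 0`.) -/
def sMin : ℝ := sInf ((fun t => |solS a u t m|) '' setO N a B m u w)

open Classical in
/-- The function on `{0, …, N-1}` that equals `fPP`, `fPM`, `fMP`, `fMM` on `𝒪₊₊`, `𝒪₊₋`, `𝒪₋₊`,
`𝒪₋₋` respectively (and `0` elsewhere). -/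
def glue (fPP fPM fMP fMM : ℕ → ℝ) (t : ℕ) : ℝ :=
  if t ∈ setPP N a B m u w then fPP t
  else if t ∈ setPM N a B m u w then fPM t
  else if t ∈ setMP N a B m u w then fMP t
  else if t ∈ setMM N a B m u w then fMM t
  else 0

/-- `∑_{i=0}^{N-1} [Ψ(i)]_n K(i)`. -/
def psiSum (K : ℕ → ℝ) : ℝ := ∑ i ∈ Finset.range N, psiLast N a B w i * K i

end SignSets

end MultipointBVP

end

open MultipointBVP

/-! ### Brouwer's fixed point theorem, by the volume-polynomial argument of Milnor and Rogers. -/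

section BrouwerFixedPoint

open Metric Set MeasureTheory

/-! The proof is a Lyapunov–Schmidt reduction combined with Brouwer's theorem. Truncate the argument
of `g` to `[-d, d]` and let `F` be the resulting bounded superposition operator. Write `x = α S +
z`. Then `ℒ x = F x` follows from `z = M_p (I - Q) F x` together with the scalar equation `H(x) = ∑
[Ψ(t)]_n g(t, [x(t)]_m) = 0`, which says `Q F x = 0`.

By weighted AM-GM, `d ^ β ≤ β d + (1 - β)`, so such a `z` satisfies `‖z‖ ≤ r` with `r = K₁ β d + K₁
(1 - β) + K₂`. Choose `ρ` with `ρ s_min = c + r`; the lower bound on `d` then gives `ρ s_max + r ≤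
d`. For `|α| ≤ ρ` the truncation of `g` is therefore inactive. For `|α| = ρ` and `t ∈ 𝒪`, the
coordinate `[x(t)]_m` has modulus in `[c, d]` and the sign of `α [S(t)]_m`. The one-sided bounds
then yield `H ≥ J₁ ≥ 0` at `α = ρ` and `H ≤ J₂ ≤ 0` at `α = -ρ`.

Clamping `α - H` to `[-ρ, ρ]` turns the system into a fixed point problem for a bounded continuous
map (`exists_clamped_fixedPoint`). At a fixed point `H > 0` would force `α = -ρ` and `H < 0` would
force `α = ρ`; both contradict the signs above, so `H = 0`. The linear input is `opL_opMpIQ`, and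
`exists_isSolution_of_opL_eq` returns to the scalar equation. -/

theorem LipschitzOnWith.indicator_closedBall {E F : Type*} [NormedAddCommGroup E]
    [NormedSpace ℝ E] [NormedAddCommGroup F] {K : NNReal} {g : E → F} {ρ : ℝ}
    (hg : LipschitzOnWith K g (closedBall 0 ρ)) (h0 : ∀ x, ‖x‖ = ρ → g x = 0) :
    LipschitzWith K ((closedBall (0 : E) ρ).indicator g) := by
  have key : ∀ x y : E, x ∈ closedBall (0 : E) ρ → y ∉ closedBall (0 : E) ρ →
      ‖g x‖ ≤ K * dist x y := by
    intro x y hx hy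
    rw [mem_closedBall_zero_iff] at hx hy
    -- A segment from inside to outside meets the sphere, where `g` vanishes; comparing `x` with
    -- that point costs at most `dist x y`.
    have hcont : ContinuousOn (fun s : ℝ => ‖AffineMap.lineMap x y s‖) (Icc 0 1) := by
      have : Continuous fun s : ℝ => (AffineMap.lineMap x y s : E) :=
        AffineMap.lineMap_continuous
      fun_prop
    obtain ⟨s, hs, hsρ⟩ := intermediate_value_Icc zero_le_one hcont
      (show ρ ∈ Icc _ _ by simpa using ⟨hx, (not_le.mp hy).le⟩)
    have hz : (AffineMap.lineMap x y s : E) ∈ closedBall (0 : E) ρ := by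
      rw [mem_closedBall_zero_iff]; exact hsρ.le
    have h1 := hg.dist_le_mul x (mem_closedBall_zero_iff.2 hx) _ hz
    rw [h0 _ hsρ, dist_zero_right, dist_left_lineMap, Real.norm_of_nonneg hs.1] at h1
    refine h1.trans (mul_le_mul_of_nonneg_left ?_ K.2)
    nlinarith [hs.2, dist_nonneg (x := x) (y := y)]
  refine LipschitzWith.of_dist_le_mul fun x y => ?_
  by_cases hx : x ∈ closedBall (0 : E) ρ <;> by_cases hy : y ∈ closedBall (0 : E) ρ
  · simpa [hx, hy] using! hg.dist_le_mul x hx y hy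
  · rw [indicator_of_mem hx, indicator_of_notMem hy, dist_zero_right]
    exact key x y hx hy
  · rw [indicator_of_notMem hx, indicator_of_mem hy, dist_zero_left, dist_comm]
    exact key y x hy hx
  · rw [indicator_of_notMem hx, indicator_of_notMem hy, dist_self]
    positivity

/-- Extend `g` by zero to `G`. Solving `x + t • G x = y` is a fixed point problem for a contraction.
A solution outside the ball would have `G x = 0`, hence `x = y`, which is impossible for `y` in the
ball. -/
theorem LipschitzOnWith.bijOn_add_smul {E : Type*} [NormedAddCommGroup E]
    [NormedSpace ℝ E] [CompleteSpace E] {K : NNReal} {g : E → E} {ρ : ℝ}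
    (hg : LipschitzOnWith K g (closedBall 0 ρ)) (h0 : ∀ x, ‖x‖ = ρ → g x = 0)
    (hr : ∀ x ∈ closedBall (0 : E) ρ, x + g x ∈ closedBall (0 : E) ρ)
    {t : ℝ} (ht0 : 0 ≤ t) (ht1 : t ≤ 1) (htK : t * K < 1) :
    BijOn (fun x => x + t • g x) (closedBall 0 ρ) (closedBall 0 ρ) := by
  have hG := hg.indicator_closedBall h0
  set G := (closedBall (0 : E) ρ).indicator g with hGdef
  have hGc : ∀ y, ContractingWith (t.toNNReal * K) fun x => y - t • G x := by
    intro y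
    refine ⟨by rw [← NNReal.coe_lt_coe]; simpa [ht0] using htK, LipschitzWith.of_dist_le_mul fun a b => ?_⟩
    rw [dist_sub_left, dist_smul₀, Real.norm_of_nonneg ht0, NNReal.coe_mul,
      Real.coe_toNNReal t ht0, mul_assoc]
    exact mul_le_mul_of_nonneg_left (hG.dist_le_mul a b) ht0
  have hmaps : MapsTo (fun x => x + t • g x) (closedBall 0 ρ) (closedBall (0 : E) ρ) := by
    intro x hx
    -- The image is the convex combination `(1 - t) x + t (x + g x)`.
    have h := (convex_closedBall (0 : E) ρ) hx (hr x hx) (sub_nonneg.2 ht1) ht0 (by ring)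
    convert h using 1
    module
  refine ⟨hmaps, ?_, ?_⟩
  · intro a ha b hb hab
    have e : ∀ z ∈ closedBall (0 : E) ρ,
        Function.IsFixedPt (fun x => z + t • g z - t • G x) z := by
      intro z hz
      simp [Function.IsFixedPt, hGdef, indicator_of_mem hz]
    have h1 := e a ha
    have h2 := e b hb
    simp only at hab
    rw [hab] at h1
    exact (hGc _).fixedPoint_unique' h1 h2
  · intro y hy
    have : Nonempty E := ⟨0⟩
    have hfix : y - t • G ((hGc y).fixedPoint) = (hGc y).fixedPoint := (hGc y).fixedPoint_isFixedPt
    set x := (hGc y).fixedPoint with hx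
    by_cases hxb : x ∈ closedBall (0 : E) ρ
    · refine ⟨x, hxb, ?_⟩
      rw [hGdef, indicator_of_mem hxb] at hfix
      simp only
      nth_rewrite 1 [← hfix]
      abel
    · rw [hGdef, indicator_of_notMem hxb, smul_zero, sub_zero] at hfix
      exact absurd (hfix ▸ hy) hxb

/-- `det (1 + t A)` is a polynomial in `t` of degree at most the dimension, so interpolation at
small nodes recovers its value at `t = 1` with weights independent of `A`. -/
theorem det_one_add_eq_sum_lagrange {E : Type*} [AddCommGroup E]
    [Module ℝ E] [FiniteDimensional ℝ E] (s : Finset ℝ) (hs : Module.finrank ℝ E < s.card)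
    (A : E →ₗ[ℝ] E) :
    LinearMap.det (1 + A) =
      ∑ t ∈ s, LinearMap.det ((1 : E →ₗ[ℝ] E) + t • A) * (Lagrange.basis s id t).eval 1 := by
  classical
  let b := Module.finBasis ℝ E
  let p : Polynomial ℝ := ((Polynomial.X : Polynomial ℝ) •
    (LinearMap.toMatrix b b A).map Polynomial.C +
      (1 : Matrix (Fin (Module.finrank ℝ E)) (Fin (Module.finrank ℝ E)) ℝ).map Polynomial.C).det
  have hp : ∀ t : ℝ, p.eval t = LinearMap.det ((1 : E →ₗ[ℝ] E) + t • A) := by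
    intro t
    rw [← LinearMap.det_toMatrix b]
    simp only [p]
    rw [← Polynomial.coe_evalRingHom, RingHom.map_det]
    congr 1
    ext i j
    simp only [map_add, map_smul, LinearMap.toMatrix_one, RingHom.mapMatrix_apply,
      Matrix.map_apply, Matrix.add_apply, Matrix.smul_apply, Matrix.one_apply]
    split_ifs <;> simp <;> ring
  have hdeg : p.degree < s.card := by
    refine lt_of_le_of_lt Polynomial.degree_le_natDegree ?_
    have := Polynomial.natDegree_det_X_add_C_le (LinearMap.toMatrix b b A) 1
    rw [Fintype.card_fin] at this
    exact_mod_cast lt_of_le_of_lt this hs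
  have h1 := Lagrange.eq_interpolate (v := id) (s := s) (f := p) (injOn_id _) hdeg
  have h2 := congrArg (Polynomial.eval 1) h1
  rw [hp, one_smul, Lagrange.interpolate_apply, Polynomial.eval_finsetSum] at h2
  rw [h2]
  refine Finset.sum_congr rfl fun t _ => ?_
  simp [hp]

theorem ContinuousLinearMap.exists_pos_forall_det_one_add_pos {E : Type*} [NormedAddCommGroup E]
    [NormedSpace ℝ E] [FiniteDimensional ℝ E] :
    ∃ ε > 0, ∀ A : E →L[ℝ] E, ‖A‖ < ε → 0 < (1 + A).det := by
  have h : ContinuousAt (fun A : E →L[ℝ] E => (1 + A).det) 0 :=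
    (ContinuousLinearMap.continuous_det.comp (by fun_prop :
      Continuous fun A : E →L[ℝ] E => 1 + A)).continuousAt
  have h1 : (0 : ℝ) < (1 + (0 : E →L[ℝ] E)).det := by
    rw [add_zero]
    exact lt_of_lt_of_eq one_pos (LinearMap.det_id (M := E) (A := ℝ)).symm
  obtain ⟨ε, hε, H⟩ := Metric.eventually_nhds_iff.1 (h.eventually (lt_mem_nhds h1))
  exact ⟨ε, hε, fun A hA => H (by simpa using hA)⟩

theorem ContinuousLinearMap.det_eq_zero_of_inner_range {E : Type*} [NormedAddCommGroup E]
    [InnerProductSpace ℝ E] [FiniteDimensional ℝ E] (A : E →L[ℝ] E) {z : E} (hz : z ≠ 0)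
    (h : ∀ v, inner ℝ z (A v) = 0) : A.det = 0 := by
  by_contra hdet
  let e := LinearMap.equivOfDetNeZero (A : E →ₗ[ℝ] E) hdet
  have := h (e.symm z)
  have h2 : A (e.symm z) = z := e.apply_symm_apply z
  rw [h2, inner_self_eq_zero] at this
  exact hz this

/-- For small `t` the map `x + t g x` is a bijection of the ball with positive Jacobian, so the
integral of `det (1 + t Dg)` is the volume. Being polynomial in `t`, this integral is the volume at
`t = 1` too. But there `‖x + g x‖` is constant, so the derivative has range orthogonal to `x + g x`
and the determinant vanishes. -/
theorem not_exists_retraction_sphere {E : Type*} [NormedAddCommGroup E]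
    [InnerProductSpace ℝ E] [FiniteDimensional ℝ E] {ρ : ℝ} (hρ : 0 < ρ) {g : E → E}
    (hg : ∀ x ∈ closedBall (0 : E) ρ, ContDiffAt ℝ 1 g x)
    (h0 : ∀ x, ‖x‖ = ρ → g x = 0) (hr : ∀ x ∈ closedBall (0 : E) ρ, ‖x + g x‖ = ρ) : False := by
  let _ : MeasurableSpace E := borel E
  have : BorelSpace E := ⟨rfl⟩
  let μ : Measure E := Measure.addHaar
  set D := closedBall (0 : E) ρ with hD
  have hDc : IsCompact D := isCompact_closedBall 0 ρ
  have hdiff : ∀ x ∈ D, DifferentiableAt ℝ g x := fun x hx =>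
    (hg x hx).differentiableAt one_ne_zero
  have hcd : ContinuousOn (fderiv ℝ g) D := fun x hx =>
    ((hg x hx).fderiv_right (m := 0) (by norm_num)).continuousAt.continuousWithinAt
  obtain ⟨C, hC⟩ := hDc.exists_bound_of_continuousOn hcd
  have hC0 : 0 ≤ C := (norm_nonneg _).trans (hC 0 (by simp [hD, hρ.le]))
  have hlip : LipschitzOnWith ⟨C, hC0⟩ g D :=
    (convex_closedBall (0 : E) ρ).lipschitzOnWith_of_nnnorm_fderiv_le hdiff
      fun x hx => by exact_mod_cast hC x hx
  obtain ⟨ε, hε, hdet⟩ := ContinuousLinearMap.exists_pos_forall_det_one_add_pos (E := E)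
  have hcdet : ∀ t : ℝ, ContinuousOn (fun x => (1 + t • fderiv ℝ g x).det) D := fun t =>
    ContinuousLinearMap.continuous_det.comp_continuousOn
      (continuousOn_const.add (hcd.const_smul t))
  have hvol : ∀ t : ℝ, 0 ≤ t → t ≤ 1 → t * C < 1 → t * C < ε →
      ∫ x in D, (1 + t • fderiv ℝ g x).det ∂μ = μ.real D := by
    intro t ht0 ht1 htC htε
    have hbij : BijOn (fun x => x + t • g x) D D :=
      hlip.bijOn_add_smul h0 (fun x hx => by
        rw [mem_closedBall_zero_iff]; exact (hr x hx).le) ht0 ht1 (by exact_mod_cast htC)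
    have hder : ∀ x ∈ D, HasFDerivWithinAt (fun x => x + t • g x) (1 + t • fderiv ℝ g x) D x :=
      fun x hx => ((hasFDerivAt_id x).add
        ((hdiff x hx).hasFDerivAt.const_smul t)).hasFDerivWithinAt
    have := integral_image_eq_integral_abs_det_fderiv_smul μ hDc.measurableSet hder hbij.injOn
      (fun _ => (1 : ℝ))
    rw [hbij.image_eq] at this
    simp only [smul_eq_mul, mul_one, integral_const, measureReal_restrict_apply_univ] at this
    rw [this]
    refine setIntegral_congr_fun hDc.measurableSet fun x hx => ?_
    refine (abs_of_pos (hdet _ ?_)).symm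
    rw [norm_smul, Real.norm_of_nonneg ht0]
    exact lt_of_le_of_lt (mul_le_mul_of_nonneg_left (hC x hx) ht0) htε
  obtain ⟨δ, hδ, hδ1, hδC, hδε⟩ : ∃ δ > 0, δ ≤ 1 ∧ δ * C < 1 ∧ δ * C < ε := by
    refine ⟨min 1 (min 1 ε / (C + 1)), by positivity, min_le_left _ _, ?_⟩
    have h1 : min 1 (min 1 ε / (C + 1)) * C < min 1 ε := by
      calc min 1 (min 1 ε / (C + 1)) * C ≤ min 1 ε / (C + 1) * C :=
            mul_le_mul_of_nonneg_right (min_le_right _ _) hC0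
        _ < min 1 ε / (C + 1) * (C + 1) := by
            apply mul_lt_mul_of_pos_left (by linarith); positivity
        _ = min 1 ε := by field_simp
    exact ⟨h1.trans_le (min_le_left _ _), h1.trans_le (min_le_right _ _)⟩
  -- Dimension plus one nodes, all small enough for the volume identity.
  obtain ⟨s, hsub, hcard⟩ := (Icc_infinite hδ).exists_subset_card_eq (Module.finrank ℝ E + 1)
  have hint : ∫ x in D, (1 + fderiv ℝ g x).det ∂μ = μ.real D := by
    have e : ∀ x, (1 + fderiv ℝ g x).det = ∑ t ∈ s, (1 + t • fderiv ℝ g x).det *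
        (Lagrange.basis s id t).eval 1 := fun x =>
      det_one_add_eq_sum_lagrange s (by omega) (fderiv ℝ g x : E →ₗ[ℝ] E)
    simp_rw [e]
    rw [integral_finsetSum _ fun t _ => ((hcdet t).integrableOn_compact hDc).mul_const _]
    simp_rw [integral_mul_const]
    rw [Finset.sum_congr rfl fun t ht => by
      have ht' := hsub ht
      rw [hvol t ht'.1 (ht'.2.trans hδ1)
        ((mul_le_mul_of_nonneg_right ht'.2 hC0).trans_lt hδC)
        ((mul_le_mul_of_nonneg_right ht'.2 hC0).trans_lt hδε)]]
    rw [← Finset.mul_sum, ← Polynomial.eval_finsetSum, Lagrange.sum_basis (injOn_id _)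
      (Finset.card_pos.1 (by omega)), Polynomial.eval_one, mul_one]
  have hzero : ∫ x in D, (1 + fderiv ℝ g x).det ∂μ = 0 := by
    refine setIntegral_eq_zero_of_forall_eq_zero fun x hx => ?_
    have hxz : x + g x ≠ 0 := by
      rw [← norm_pos_iff, hr x hx]; exact hρ
    have hud : UniqueDiffWithinAt ℝ D x :=
      uniqueDiffOn_convex (convex_closedBall _ _)
        ⟨0, ball_subset_interior_closedBall (mem_ball_self hρ)⟩ x hx
    have hd1 : HasFDerivWithinAt (fun x => x + g x) (1 + fderiv ℝ g x) D x :=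
      ((hasFDerivAt_id x).add (hdiff x hx).hasFDerivAt).hasFDerivWithinAt
    have hd2 : HasFDerivWithinAt (fun x => ‖x + g x‖ ^ 2) (0 : E →L[ℝ] ℝ) D x :=
      (hasFDerivWithinAt_const (ρ ^ 2) x D).congr (fun y hy => by rw [hr y hy])
        (by rw [hr x hx])
    have heq := hud.eq hd1.norm_sq hd2
    refine ContinuousLinearMap.det_eq_zero_of_inner_range _ hxz fun v => ?_
    have := congrArg (fun L : E →L[ℝ] ℝ => L v) heq
    simp only [ContinuousLinearMap.comp_apply, zero_apply, smul_apply,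
      innerSL_apply_apply] at this
    simpa using this
  have hpos : 0 < μ.real D :=
    ENNReal.toReal_pos (measure_closedBall_pos μ 0 hρ).ne' hDc.measure_lt_top.ne
  linarith

/-- Without a fixed point, the ray from `p x` through `x` hits the sphere at `x + s x • (x - p x)`,
a retraction. Here `s` is the larger root of a quadratic. Its discriminant stays positive up to the
sphere because `p` maps into the open ball, so `s` is `C¹`. -/
theorem exists_fixedPoint_of_contDiff_of_mapsTo_ball {E : Type*} [NormedAddCommGroup E]
    [InnerProductSpace ℝ E] [FiniteDimensional ℝ E] {ρ : ℝ} (hρ : 0 < ρ) {p : E → E}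
    (hp : ContDiff ℝ 1 p) (hmaps : MapsTo p (closedBall 0 ρ) (ball 0 ρ)) :
    ∃ x ∈ closedBall (0 : E) ρ, p x = x := by
  by_contra! hfix
  have hv : ∀ x ∈ closedBall (0 : E) ρ, x - p x ≠ 0 := fun x hx h =>
    hfix x hx (sub_eq_zero.1 h).symm
  have hb : ∀ x, ‖x‖ = ρ → 0 < inner ℝ x (x - p x) := by
    intro x hx
    have h1 := hmaps (mem_closedBall_zero_iff.2 hx.le)
    rw [mem_ball_zero_iff] at h1
    rw [inner_sub_right, real_inner_self_eq_norm_sq]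
    have := real_inner_le_norm x (p x)
    rw [hx] at this ⊢
    nlinarith
  have hdisc : ∀ x ∈ closedBall (0 : E) ρ,
      0 < inner ℝ x (x - p x) ^ 2 + ‖x - p x‖ ^ 2 * (ρ ^ 2 - ‖x‖ ^ 2) := by
    intro x hx
    have hvx := norm_pos_iff.2 (hv x hx)
    rw [mem_closedBall_zero_iff] at hx
    rcases hx.eq_or_lt with h | h
    · have := hb x h
      rw [h]; simp only [sub_self, mul_zero, add_zero]; positivity
    · have : 0 < ρ ^ 2 - ‖x‖ ^ 2 := by nlinarith [norm_nonneg x]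
      positivity
  let s : E → ℝ := fun x => (-inner ℝ x (x - p x) +
    √(inner ℝ x (x - p x) ^ 2 + ‖x - p x‖ ^ 2 * (ρ ^ 2 - ‖x‖ ^ 2))) / ‖x - p x‖ ^ 2
  refine not_exists_retraction_sphere hρ (g := fun x => s x • (x - p x)) ?_ ?_ ?_
  · intro x hx
    have hvc : ContDiff ℝ 1 fun x => x - p x := contDiff_id.sub hp
    have hi : ContDiff ℝ 1 fun x => (inner ℝ x (x - p x) : ℝ) := contDiff_id.inner ℝ hvc
    have hn : ContDiff ℝ 1 fun x => ‖x - p x‖ ^ 2 := hvc.norm_sq ℝ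
    have hn' : ContDiff ℝ 1 fun x : E => ‖x‖ ^ 2 := contDiff_id.norm_sq ℝ
    have hd : ContDiff ℝ 1 fun x => (inner ℝ x (x - p x) : ℝ) ^ 2 +
        ‖x - p x‖ ^ 2 * (ρ ^ 2 - ‖x‖ ^ 2) := (hi.pow 2).add (hn.mul (contDiff_const.sub hn'))
    refine ContDiffAt.smul (ContDiffAt.div ?_ hn.contDiffAt ?_) hvc.contDiffAt
    · exact hi.neg.contDiffAt.add (hd.contDiffAt.sqrt (hdisc x hx).ne')
    · exact pow_ne_zero _ (norm_ne_zero_iff.2 (hv x hx))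
  · intro x hx
    have : s x = 0 := by
      simp only [s, hx, sub_self, mul_zero, add_zero]
      rw [Real.sqrt_sq (hb x hx).le]; simp
    simp [this]
  · intro x hx
    have hvx := norm_ne_zero_iff.2 (hv x hx)
    refine (sq_eq_sq₀ (norm_nonneg _) hρ.le).1 ?_
    rw [norm_add_sq_real, inner_smul_right, norm_smul, mul_pow, Real.norm_eq_abs, sq_abs]
    have hsq := Real.sq_sqrt (hdisc x hx).le
    simp only [s]
    field_simp
    linear_combination hsq

/-- If `f` had no fixed point, its displacement would have a positive minimum on the ball of radius
`R + 1`. A `C¹` approximation closer than that minimum, and closer than `1`, has a fixed point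
there: a contradiction. -/
theorem EuclideanSpace.exists_fixedPoint_of_bounded {ι : Type*} [Fintype ι]
    {f : EuclideanSpace ℝ ι → EuclideanSpace ℝ ι} (hf : Continuous f) {R : ℝ}
    (hR : ∀ x, ‖f x‖ ≤ R) : ∃ x, f x = x := by
  by_contra! hfix
  have hR0 : 0 ≤ R := (norm_nonneg _).trans (hR 0)
  obtain ⟨x₀, -, hx₀⟩ := (isCompact_closedBall (0 : EuclideanSpace ℝ ι) (R + 1)).exists_isMinOn
    ⟨0, by simp; linarith⟩ (f := fun x => dist (f x) x) (by fun_prop)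
  have hδ : 0 < dist (f x₀) x₀ := dist_pos.2 (hfix x₀)
  obtain ⟨p, hp, hpf, -⟩ := hf.exists_contDiff_approx 1
    (ε := fun _ => min 1 (dist (f x₀) x₀)) continuous_const fun _ => lt_min one_pos hδ
  obtain ⟨x, hx, hpx⟩ := exists_fixedPoint_of_contDiff_of_mapsTo_ball (by linarith : 0 < R + 1)
    hp fun x _ => by
      have h1 := (hpf x).trans_le (min_le_left _ _)
      rw [dist_eq_norm] at h1
      rw [mem_ball_zero_iff]
      linarith [norm_le_norm_add_norm_sub (f x) (p x), norm_sub_rev (f x) (p x), hR x]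
  have h1 := (hpf x).trans_le (min_le_right _ _)
  rw [hpx, dist_comm] at h1
  exact absurd (isMinOn_iff.1 hx₀ x hx) (not_le.2 h1)

theorem exists_fixedPoint_of_continuous_bounded {E : Type*} [NormedAddCommGroup E]
    [NormedSpace ℝ E] [FiniteDimensional ℝ E] {f : E → E} (hf : Continuous f) {R : ℝ}
    (hR : ∀ x, ‖f x‖ ≤ R) : ∃ x, f x = x := by
  let e : E ≃L[ℝ] EuclideanSpace ℝ (Fin (Module.finrank ℝ E)) := toEuclidean
  obtain ⟨y, hy⟩ := EuclideanSpace.exists_fixedPoint_of_bounded (f := fun y => e (f (e.symm y)))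
    (by fun_prop) (R := ‖e.toContinuousLinearMap‖ * R) fun y =>
      (e.toContinuousLinearMap.le_opNorm (f (e.symm y))).trans (mul_le_mul_of_nonneg_left (hR _) (norm_nonneg _))
  exact ⟨e.symm y, by rw [← e.symm_apply_apply (f (e.symm y)), hy]⟩

end BrouwerFixedPoint

noncomputable section

namespace MultipointBVP

/-! ### The linear problem: kernel and image of `ℒ`, and passage to the scalar equation. -/

section LinearProblem

variable {n : ℕ} {N : ℕ} {a : ℕ → Fin n → ℝ} {B : ℕ → Matrix (Fin n) (Fin n) ℝ}

theorem toEuclideanLin_mul_apply (C D : Matrix (Fin n) (Fin n) ℝ)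
    (v : EuclideanSpace ℝ (Fin n)) :
    Matrix.toEuclideanLin (C * D) v = Matrix.toEuclideanLin C (Matrix.toEuclideanLin D v) := by
  simp [Matrix.toLpLin_apply, Matrix.mulVec_mulVec]

theorem toEuclideanLin_one_apply (v : EuclideanSpace ℝ (Fin n)) :
    Matrix.toEuclideanLin (1 : Matrix (Fin n) (Fin n) ℝ) v = v := by
  simp

theorem inner_toEuclideanLin_transpose (C : Matrix (Fin n) (Fin n) ℝ)
    (v x : EuclideanSpace ℝ (Fin n)) :
    inner ℝ (Matrix.toEuclideanLin Cᵀ v) x = inner ℝ v (Matrix.toEuclideanLin C x) := by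
  rw [← Matrix.conjTranspose_eq_transpose_of_trivial, Matrix.toEuclideanLin_conjTranspose_eq_adjoint,
    LinearMap.adjoint_inner_left]

theorem companion_apply_of_lt (a : ℕ → Fin n → ℝ) (t : ℕ) (v : EuclideanSpace ℝ (Fin n))
    {i : Fin n} (hi : (i : ℕ) + 1 < n) :
    Matrix.toEuclideanLin (companion a t) v i = v ⟨i + 1, hi⟩ := by
  simp only [Matrix.toLpLin_apply, Matrix.mulVec, dotProduct, companion, Matrix.of_apply]
  rw [Finset.sum_eq_single ⟨i + 1, hi⟩]
  · simp [hi.ne]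
  · intro j _ hj
    have : (j : ℕ) ≠ i + 1 := fun h => hj (Fin.ext h)
    simp [hi.ne, this]
  · simp

theorem companion_apply_lastIdx [NeZero n] (a : ℕ → Fin n → ℝ) (t : ℕ)
    (v : EuclideanSpace ℝ (Fin n)) :
    Matrix.toEuclideanLin (companion a t) v (lastIdx n) = -∑ j, a t j * v j := by
  have : ((lastIdx n : Fin n) : ℕ) + 1 = n := Nat.sub_add_cancel (NeZero.pos n)
  simp [Matrix.toLpLin_apply, Matrix.mulVec, dotProduct, companion, this]

theorem isUnit_companion [NeZero n] {t : ℕ} (ha : a t 0 ≠ 0) : IsUnit (companion a t) := by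
  rw [← Matrix.mulVec_injective_iff_isUnit]
  rw [← Matrix.coe_mulVecLin, ← LinearMap.ker_eq_bot, LinearMap.ker_eq_bot']
  intro v hv
  set V : EuclideanSpace ℝ (Fin n) := WithLp.toLp 2 v
  have hV : Matrix.toEuclideanLin (companion a t) V = 0 := by
    have : companion a t *ᵥ v = 0 := hv
    simp [Matrix.toLpLin_apply, V, this]
  have hsucc : ∀ j : Fin n, j ≠ 0 → v j = 0 := by
    intro j hj
    have hj0 : (j : ℕ) ≠ 0 := fun h => hj (Fin.ext (by simpa using h))
    have hlt : (j : ℕ) - 1 < n := by omega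
    have h := companion_apply_of_lt a t V (i := ⟨j - 1, hlt⟩) (by simp only; omega)
    rw [hV] at h
    simp only [PiLp.zero_apply] at h
    rw [h]
    simp only [V]
    congr 1
    ext
    simp only
    omega
  have hlast := companion_apply_lastIdx a t V
  rw [hV, Finset.sum_eq_single 0 (fun j _ hj => by simp [V, hsucc j hj]) (by simp)] at hlast
  simp only [PiLp.zero_apply] at hlast
  have h0 : v 0 = 0 := by
    have : a t 0 * v 0 = 0 := by simpa [V] using hlast
    exact (mul_eq_zero.1 this).resolve_left ha
  funext j
  by_cases hj : j = 0
  · rw [hj, h0]; rfl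
  · exact hsucc j hj

theorem isUnit_fundMat [NeZero n] (ha : ∀ t < N, a t 0 ≠ 0) {t : ℕ} (ht : t ≤ N) :
    IsUnit (fundMat a t) := by
  induction t with
  | zero => exact isUnit_one
  | succ t ih => exact (isUnit_companion (ha t ht)).mul (ih (Nat.le_of_succ_le ht))

theorem bdryMat_apply (v : EuclideanSpace ℝ (Fin n)) :
    Matrix.toEuclideanLin (bdryMat N a B) v = ∑ i ∈ Finset.range (N + 1),
      Matrix.toEuclideanLin (B i) (Matrix.toEuclideanLin (fundMat a i) v) := by
  rw [bdryMat, map_sum, LinearMap.sum_apply]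
  exact Finset.sum_congr rfl fun i _ => toEuclideanLin_mul_apply _ _ _

theorem eq_fundMat_of_opL_eq_zero {x : spaceX N B} (hx : opL N a B x = 0) (t : Fin (N + 1)) :
    x.1 t = Matrix.toEuclideanLin (fundMat a t) (x.1 0) := by
  induction t using Fin.induction with
  | zero => exact (toEuclideanLin_one_apply _).symm
  | succ t ih =>
    have h : x.1 t.succ - Matrix.toEuclideanLin (companion a t) (x.1 t.castSucc) = 0 :=
      congrFun hx t
    rw [sub_eq_zero.1 h, ih, Fin.val_succ, fundMat, toEuclideanLin_mul_apply, Fin.val_castSucc]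

theorem projP_eq_self_of_opL_eq_zero {x : spaceX N B} (hx : opL N a B x = 0) :
    projP N a B x = x := by
  have h0 : x.1 0 ∈ matKer (bdryMat N a B) := by
    rw [LinearMap.mem_ker, bdryMat_apply, Finset.sum_range]
    refine Eq.trans (Finset.sum_congr rfl fun i _ => ?_)
      (x.2 : ∑ i : Fin (N + 1), Matrix.toEuclideanLin (B i) (x.1 i) = 0)
    rw [← eq_fundMat_of_opL_eq_zero hx]
  ext1
  funext t
  change Matrix.toEuclideanLin (fundMat a t)
      ((matKer (bdryMat N a B)).starProjection (x.1 0)) = _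
  rw [Submodule.starProjection_eq_self_iff.2 h0, ← eq_fundMat_of_opL_eq_zero hx]

theorem opL_fundMat {v : EuclideanSpace ℝ (Fin n)} (hv : v ∈ matKer (bdryMat N a B)) :
    opL N a B ⟨_, fundMat_mem_spaceX hv⟩ = 0 := by
  funext t
  change Matrix.toEuclideanLin (fundMat a (t.succ : ℕ)) v - Matrix.toEuclideanLin (companion a t)
    (Matrix.toEuclideanLin (fundMat a (t.castSucc : ℕ)) v) = 0
  rw [← toEuclideanLin_mul_apply]
  exact sub_self _

theorem ker_opLKerP : LinearMap.ker (opLKerP N a B) = ⊥ := by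
  rw [LinearMap.ker_eq_bot']
  rintro ⟨x, hx⟩ h
  have hx0 := projP_eq_self_of_opL_eq_zero (show opL N a B x = 0 from h)
  rw [LinearMap.mem_ker.1 hx] at hx0
  exact Subtype.ext hx0.symm

/-- Subtracting `P x` lands in `Ker P` and leaves `ℒ x` unchanged, since `ℒ P = 0`. -/
theorem exists_opLKerP_eq (x : spaceX N B) : ∃ z, opLKerP N a B z = opL N a B x := by
  have h1 : opL N a B (projP N a B x) = 0 :=
    opL_fundMat (Submodule.starProjection_apply_mem _ (x.1 0))
  refine ⟨⟨x - projP N a B x, ?_⟩, ?_⟩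
  · rw [LinearMap.mem_ker, map_sub, projP_eq_self_of_opL_eq_zero h1, sub_self]
  · change opL N a B (x - projP N a B x) = _
    rw [map_sub, h1, sub_zero]

/-- Variation of constants. -/
def varConst (a : ℕ → Fin n → ℝ) (h : ℕ → EuclideanSpace ℝ (Fin n))
    (v : EuclideanSpace ℝ (Fin n)) (t : ℕ) : EuclideanSpace ℝ (Fin n) :=
  Matrix.toEuclideanLin (fundMat a t)
    (v + ∑ j ∈ Finset.range t, Matrix.toEuclideanLin (fundMat a (j + 1))⁻¹ (h j))

theorem varConst_succ [NeZero n] (ha : ∀ t < N, a t 0 ≠ 0) (h : ℕ → EuclideanSpace ℝ (Fin n))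
    (v : EuclideanSpace ℝ (Fin n)) {t : ℕ} (ht : t < N) :
    varConst a h v (t + 1) = Matrix.toEuclideanLin (companion a t) (varConst a h v t) + h t := by
  have hu : IsUnit (fundMat a (t + 1)).det :=
    (Matrix.isUnit_iff_isUnit_det _).1 (isUnit_fundMat ha ht)
  rw [varConst, Finset.sum_range_succ, ← add_assoc, map_add, ← toEuclideanLin_mul_apply _ _ (h t),
    Matrix.mul_nonsing_inv _ hu, toEuclideanLin_one_apply, fundMat, toEuclideanLin_mul_apply,
    varConst]

/-- Exchanging the order of summation shows what `Ψ` is for: pairing it with `h` tests the boundary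
value of the particular solution with zero initial value against `w`. -/
theorem sum_inner_adjPsi (w : EuclideanSpace ℝ (Fin n)) (h : ℕ → EuclideanSpace ℝ (Fin n)) :
    ∑ j ∈ Finset.range N, inner ℝ (adjPsi N a B w j) (h j) =
      inner ℝ w (∑ i ∈ Finset.range (N + 1), Matrix.toEuclideanLin (B i) (varConst a h 0 i)) := by
  simp only [adjPsi, sum_inner, inner_sum, inner_toEuclideanLin_transpose, varConst, zero_add,
    map_sum, toEuclideanLin_mul_apply]
  refine Finset.sum_comm' fun i j => ?_
  simp only [Finset.mem_range, Finset.mem_Icc]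
  omega

/-- With `M` for `bdryMat` and `b` the boundary value of the particular solution, a suitable initial
value exists iff `b` lies in the range of `M`, that is, iff `b` is orthogonal to `ker Mᵀ`, spanned
by `w`. -/
theorem exists_opL_eq [NeZero n] (ha : ∀ t < N, a t 0 ≠ 0) {w : EuclideanSpace ℝ (Fin n)}
    (hw : Submodule.span ℝ {w} = matKer (bdryMat N a B)ᵀ) {h : spaceZ n N}
    (hh : ∑ i : Fin N, inner ℝ (adjPsi N a B w i) (h i) = 0) : ∃ x, opL N a B x = h := by
  let h' : ℕ → EuclideanSpace ℝ (Fin n) := fun t => if ht : t < N then h ⟨t, ht⟩ else 0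
  have hh' : ∀ t : Fin N, h' t = h t := fun t => by simp [h']
  set b := ∑ i ∈ Finset.range (N + 1), Matrix.toEuclideanLin (B i) (varConst a h' 0 i) with hb
  have hwb : inner ℝ w b = 0 := by
    rw [hb, ← sum_inner_adjPsi, Finset.sum_range]
    simpa only [hh'] using hh
  have hbr : b ∈ LinearMap.range (Matrix.toEuclideanLin (bdryMat N a B)) := by
    rw [← Submodule.orthogonal_orthogonal (LinearMap.range _), Submodule.mem_orthogonal]
    intro z hz
    have hz' : z ∈ matKer (bdryMat N a B)ᵀ := by
      rw [LinearMap.mem_ker]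
      refine ext_inner_right ℝ fun y => ?_
      rw [inner_toEuclideanLin_transpose, inner_zero_left, real_inner_comm]
      exact (Submodule.mem_orthogonal _ _).1 hz _ ⟨y, rfl⟩
    rw [← hw] at hz'
    obtain ⟨c, rfl⟩ := Submodule.mem_span_singleton.1 hz'
    rw [inner_smul_left, hwb, mul_zero]
  obtain ⟨v, hv⟩ := hbr
  -- The boundary sum with initial value `-v` is `b - M v = 0`.
  refine ⟨⟨fun t => varConst a h' (-v) t, ?_⟩, ?_⟩
  · change ∑ i : Fin (N + 1), Matrix.toEuclideanLin (B i) (varConst a h' (-v) i) = 0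
    rw [← Finset.sum_range fun i => Matrix.toEuclideanLin (B i) (varConst a h' (-v) i)]
    have e : ∀ i, varConst a h' (-v) i =
        varConst a h' 0 i - Matrix.toEuclideanLin (fundMat a i) v := fun i => by
      simp only [varConst, map_add, map_neg, zero_add]
      abel
    simp only [e, map_sub, Finset.sum_sub_distrib]
    rw [← bdryMat_apply, hv, sub_self]
  · funext t
    change varConst a h' (-v) (t + 1) -
      Matrix.toEuclideanLin (companion a t) (varConst a h' (-v) t) = h t
    rw [varConst_succ ha _ _ t.2, add_sub_cancel_left, hh']

theorem sum_inner_sub_projQ {w : EuclideanSpace ℝ (Fin n)}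
    (hΨ : ∑ j : Fin N, ‖adjPsi N a B w j‖ ^ 2 ≠ 0) (h : spaceZ n N) :
    ∑ i : Fin N, inner ℝ (adjPsi N a B w i) ((h - projQ N a B w h) i) = 0 := by
  have e : ∀ i : Fin N, projQ N a B w h i = ((∑ j : Fin N, ‖adjPsi N a B w j‖ ^ 2)⁻¹ *
    ∑ i : Fin N, inner ℝ (adjPsi N a B w i) (h i)) • adjPsi N a B w i := fun i => rfl
  simp only [Pi.sub_apply, inner_sub_right, Finset.sum_sub_distrib, e, inner_smul_right,
    real_inner_self_eq_norm_sq, ← Finset.mul_sum]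
  field_simp
  ring

theorem opL_opMpIQ [NeZero n] (ha : ∀ t < N, a t 0 ≠ 0) {w : EuclideanSpace ℝ (Fin n)}
    (hw : Submodule.span ℝ {w} = matKer (bdryMat N a B)ᵀ)
    (hΨ : ∑ j : Fin N, ‖adjPsi N a B w j‖ ^ 2 ≠ 0) {h : spaceZ n N} :
    opL N a B (opMpIQ N a B w h) = h - projQ N a B w h := by
  obtain ⟨x, hx⟩ := exists_opL_eq ha hw (sum_inner_sub_projQ hΨ h)
  obtain ⟨z, hz⟩ := exists_opLKerP_eq (a := a) x
  change opLKerP N a B (LinearMap.leftInverse (opLKerP N a B) (h - projQ N a B w h)) = _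
  rw [← hx, ← hz]
  exact congrArg _ (LinearMap.leftInverse_apply_of_inj (K := ℝ)
    (V := LinearMap.ker (projP N a B)) (V' := spaceZ n N) ker_opLKerP z)

/-- A solution of the first-order system with the scalar forcing yields a solution of the
scalar problem. -/
theorem exists_isSolution_of_opL_eq [NeZero n] {m : Fin n} {g : ℝ → ℝ → ℝ} (x : spaceX N B)
    (hx : ∀ t : Fin N, opL N a B x t =
      EuclideanSpace.single (lastIdx n) (g t (x.1 t.castSucc m))) :
    ∃ y : ℕ → ℝ, IsSolution N a B m g y := by
  -- Up to time `N` take first coordinates; the remaining `n - 1` values are the other coordinates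
  -- of `x(N)`.
  let y : ℕ → ℝ := fun k =>
    if hk : k ≤ N then x.1 ⟨k, Nat.lt_succ_of_le hk⟩ 0
    else if hk' : k - N < n then x.1 (Fin.last N) ⟨k - N, hk'⟩ else 0
  have hstep : ∀ t : Fin N, x.1 t.succ = Matrix.toEuclideanLin (companion a t) (x.1 t.castSucc) +
      EuclideanSpace.single (lastIdx n) (g t (x.1 t.castSucc m)) := by
    intro t
    rw [← hx t]
    change _ = _ + (x.1 t.succ - Matrix.toEuclideanLin (companion a t) (x.1 t.castSucc))
    abel
  -- Backward induction: for `j ≥ 1` the companion structure gives `x_j(t) = x_{j-1}(t+1)`.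
  have hy : ∀ t : Fin (N + 1), ∀ j : Fin n, x.1 t j = y (t + j) := by
    intro t
    induction t using Fin.reverseInduction with
    | last =>
      intro j
      by_cases hj : (j : ℕ) = 0
      · have : j = 0 := Fin.ext (by simpa using hj)
        subst this
        simp [y, Fin.last]
      · have h1 : ¬ ((Fin.last N : Fin (N + 1)) : ℕ) + (j : ℕ) ≤ N := by
          rw [Fin.val_last]; omega
        simp [y, hj]
    | cast t ih =>
      intro j
      by_cases hj : (j : ℕ) = 0
      · have : j = 0 := Fin.ext (by simpa using hj)
        subst this
        have h1 : (t : ℕ) ≤ N := t.2.le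
        simp only [Fin.val_castSucc, Fin.val_zero, add_zero, y, h1, dif_pos]
        rfl
      · have hlt : (j : ℕ) - 1 < n := by omega
        have hlt' : (j : ℕ) - 1 + 1 < n := by omega
        have h := ih ⟨j - 1, hlt⟩
        rw [hstep, PiLp.add_apply, companion_apply_of_lt _ _ _ (i := ⟨j - 1, hlt⟩) hlt'] at h
        have hne : (⟨j - 1, hlt⟩ : Fin n) ≠ lastIdx n := by
          intro h
          have := congrArg Fin.val h
          simp only [lastIdx] at this
          omega
        have hj' : (⟨(j : ℕ) - 1 + 1, hlt'⟩ : Fin n) = j := Fin.ext (by simp only; omega)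
        simp only [PiLp.single_apply, hne, if_false, add_zero, hj'] at h
        rw [h, Fin.val_succ, Fin.val_castSucc]
        congr 1
        omega
  refine ⟨y, fun t ht => ?_, fun i => ?_⟩
  · have h := congrArg (fun v : EuclideanSpace ℝ (Fin n) => v (lastIdx n)) (hstep ⟨t, ht⟩)
    simp only [PiLp.add_apply, companion_apply_lastIdx, hy, Fin.val_succ, Fin.val_castSucc,
      PiLp.single_apply, if_true] at h
    have e : t + 1 + (lastIdx n : Fin n) = t + n := by
      have := NeZero.pos n
      simp only [lastIdx]; omega
    rw [e] at h
    rw [h]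
    ring
  · have h := congrArg (fun v : EuclideanSpace ℝ (Fin n) => v i)
      (x.2 : ∑ i : Fin (N + 1), Matrix.toEuclideanLin (B i) (x.1 i) = 0)
    rw [Finset.sum_range]
    simpa [Matrix.toLpLin_apply, Matrix.mulVec, dotProduct, hy] using h

end LinearProblem

/-! ### Truncation, sign estimates and the finite-dimensional fixed point problem. -/

section NonlinearProblem

/-- Truncation of a real number to `[-r, r]`. -/
def clamp (r x : ℝ) : ℝ := max (-r) (min x r)

theorem continuous_clamp (r : ℝ) : Continuous (clamp r) := by
  unfold clamp
  fun_prop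

theorem abs_clamp_le {r : ℝ} (hr : 0 ≤ r) (x : ℝ) : |clamp r x| ≤ r :=
  abs_le.2 ⟨le_max_left _ _, max_le (by linarith) (min_le_right _ _)⟩

theorem clamp_eq_self {r x : ℝ} (h : |x| ≤ r) : clamp r x = x := by
  rw [abs_le] at h
  rw [clamp, min_eq_left h.2, max_eq_right h.1]

theorem eq_neg_of_clamp_sub_eq {r x η : ℝ} (h : clamp r (x - η) = x) (hη : 0 < η) : x = -r := by
  rcases max_cases (-r) (min (x - η) r) with ⟨h1, -⟩ | ⟨h1, -⟩
  · exact (h.symm.trans h1)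
  · have := h.symm.trans h1
    linarith [min_le_left (x - η) r]

theorem eq_of_clamp_sub_eq {r x η : ℝ} (hr : 0 ≤ r) (h : clamp r (x - η) = x) (hη : η < 0) :
    x = r := by
  have h1 : min (x - η) r ≤ x := (le_max_right _ _).trans_eq h
  have h2 : x ≤ r := h ▸ (le_abs_self _).trans (abs_clamp_le hr _)
  rcases min_cases (x - η) r with ⟨h3, -⟩ | ⟨h3, -⟩ <;> linarith

variable {n : ℕ} {N : ℕ} {a : ℕ → Fin n → ℝ} {B : ℕ → Matrix (Fin n) (Fin n) ℝ}
  {m : Fin n} {u w : EuclideanSpace ℝ (Fin n)} {fPP fPM fMP fMM : ℕ → ℝ} {t : ℕ} {γ : ℝ}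

theorem le_sMax (ht : t < N) : |solS a u t m| ≤ sMax N a m u :=
  le_ciSup (f := fun s : Fin N => |solS a u s m|) (Set.finite_range _).bddAbove ⟨t, ht⟩

theorem sMax_nonneg : 0 ≤ sMax N a m u := Real.iSup_nonneg fun _ => abs_nonneg _

theorem projQ_eq_zero {h : spaceZ n N}
    (hh : ∑ i : Fin N, inner ℝ (adjPsi N a B w i) (h i) = 0) : projQ N a B w h = 0 := by
  funext t
  change (_ * ∑ i : Fin N, inner ℝ (adjPsi N a B w i) (h i)) • adjPsi N a B w t = 0
  rw [hh, mul_zero, zero_smul]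

variable [NeZero n]

/-- Multiplying by `[Ψ(t)]_n < 0` reverses inequalities, hence the opposite directions on `𝒪₋₊` and
`𝒪₋₋`. -/
theorem psiLast_mul_glue_le (hC1 : setZero N a B m u w = ∅) (ht : t < N)
    (hPP : t ∈ setPP N a B m u w → fPP t ≤ γ) (hPM : t ∈ setPM N a B m u w → fPM t ≤ γ)
    (hMP : t ∈ setMP N a B m u w → γ ≤ fMP t) (hMM : t ∈ setMM N a B m u w → γ ≤ fMM t) :
    psiLast N a B w t * glue N a B m u w fPP fPM fMP fMM t ≤ psiLast N a B w t * γ := by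
  unfold glue
  split_ifs with h1 h2 h3 h4
  · exact mul_le_mul_of_nonneg_left (hPP h1) h1.2.1.le
  · exact mul_le_mul_of_nonneg_left (hPM h2) h2.2.1.le
  · exact mul_le_mul_of_nonpos_left (hMP h3) h3.2.1.le
  · exact mul_le_mul_of_nonpos_left (hMM h4) h4.2.1.le
  -- Outside the four sign sets, emptiness of `𝒪₀` leaves only `[Ψ(t)]_n = 0`.
  · have h0 : t ∉ setZero N a B m u w := by simp [hC1]
    suffices psiLast N a B w t = 0 by simp [this]
    by_contra hne
    rcases lt_or_gt_of_ne hne with hΨ | hΨ <;>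
      rcases lt_trichotomy (solS a u t m) 0 with hS | hS | hS
    exacts [h4 ⟨ht, hΨ, hS⟩, h0 ⟨ht, hne, hS⟩, h3 ⟨ht, hΨ, hS⟩, h2 ⟨ht, hΨ, hS⟩,
      h0 ⟨ht, hne, hS⟩, h1 ⟨ht, hΨ, hS⟩]

theorem glue_neg : glue N a B m u w (-fPP) (-fPM) (-fMP) (-fMM) t =
    -glue N a B m u w fPP fPM fMP fMM t := by
  unfold glue
  split_ifs <;> simp

theorem le_psiLast_mul_glue (hC1 : setZero N a B m u w = ∅) (ht : t < N)
    (hPP : t ∈ setPP N a B m u w → γ ≤ fPP t) (hPM : t ∈ setPM N a B m u w → γ ≤ fPM t)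
    (hMP : t ∈ setMP N a B m u w → fMP t ≤ γ) (hMM : t ∈ setMM N a B m u w → fMM t ≤ γ) :
    psiLast N a B w t * γ ≤ psiLast N a B w t * glue N a B m u w fPP fPM fMP fMM t := by
  have := psiLast_mul_glue_le (γ := -γ) (fPP := -fPP) (fPM := -fPM) (fMP := -fMP) (fMM := -fMM)
    hC1 ht (fun h => neg_le_neg (hPP h)) (fun h => neg_le_neg (hPM h))
    (fun h => neg_le_neg (hMP h)) (fun h => neg_le_neg (hMM h))
  rw [glue_neg] at this
  linarith

theorem sMin_le (ht : t ∈ setO N a B m u w) : sMin N a B m u w ≤ |solS a u t m| :=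
  csInf_le ⟨0, by rintro _ ⟨s, -, rfl⟩; exact abs_nonneg _⟩ ⟨t, ht, rfl⟩

theorem sMin_nonneg : 0 ≤ sMin N a B m u w :=
  Real.sInf_nonneg (by rintro _ ⟨s, -, rfl⟩; exact abs_nonneg _)

theorem sum_sq_norm_adjPsi_ne_zero (h : (setO N a B m u w).Nonempty) :
    ∑ j : Fin N, ‖adjPsi N a B w j‖ ^ 2 ≠ 0 := by
  obtain ⟨t, ht⟩ := h
  have ht' : t < N ∧ psiLast N a B w t ≠ 0 := by
    rcases ht with ((h | h) | h) | h
    exacts [⟨h.1, h.2.1.ne'⟩, ⟨h.1, h.2.1.ne'⟩, ⟨h.1, h.2.1.ne⟩, ⟨h.1, h.2.1.ne⟩]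
  intro h0
  rw [Finset.sum_eq_zero_iff_of_nonneg fun _ _ => by positivity] at h0
  have h1 := h0 ⟨t, ht'.1⟩ (Finset.mem_univ _)
  rw [sq_eq_zero_iff, norm_eq_zero] at h1
  exact ht'.2 (by simp only [psiLast]; simp only at h1; rw [h1]; rfl)

/-- The superposition operator of the nonlinearity truncated to `[-d, d]`. -/
def truncF (N : ℕ) (B : ℕ → Matrix (Fin n) (Fin n) ℝ) (m : Fin n) (g : ℝ → ℝ → ℝ) (d : ℝ)
    (x : spaceX N B) : spaceZ n N :=
  fun t => EuclideanSpace.single (lastIdx n) (g t (clamp d (x.1 t.castSucc m)))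

theorem continuous_truncF {g : ℝ → ℝ → ℝ} (hg : Continuous fun p : ℝ × ℝ => g p.1 p.2) (d : ℝ) :
    Continuous (truncF N B m g d) := by
  refine continuous_pi fun t => ?_
  have h1 : Continuous fun x : spaceX N B => x.1 t.castSucc m := (PiLp.continuous_apply 2 _ m).comp
    ((continuous_apply t.castSucc).comp continuous_subtype_val)
  have h2 : Continuous fun x : spaceX N B => g t (clamp d (x.1 t.castSucc m)) :=
    hg.comp (continuous_const.prodMk ((continuous_clamp d).comp h1))
  have h3 : ∀ s : ℝ, EuclideanSpace.single (lastIdx n) s =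
      s • EuclideanSpace.single (lastIdx n) (1 : ℝ) := fun s => by
    ext i
    simp [PiLp.single_apply]
  simp only [truncF]
  simp_rw [h3 (g _ _)]
  exact h2.smul continuous_const

theorem norm_truncF_le {g : ℝ → ℝ → ℝ} {d M₁ M₂ β : ℝ} (hd : 0 < d) (hM₁ : 0 < M₁) (hM₂ : 0 < M₂)
    (hβ : 0 < β) (hβ1 : β ≤ 1)
    (hgrowth : ∀ t < N, ∀ x ∈ Set.Icc (-d) d, |g t x| ≤ M₁ * |x| ^ β + M₂) (x : spaceX N B) :
    ‖truncF N B m g d x‖ ≤ M₁ * (β * d + (1 - β)) + M₂ := by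
  -- Weighted AM-GM for `d` and `1` makes the growth bound affine in `d`.
  have hpow : d ^ β ≤ β * d + (1 - β) := by
    have := Real.geom_mean_le_arith_mean2_weighted hβ.le (sub_nonneg.2 hβ1) hd.le zero_le_one
      (by ring)
    simpa using this
  have h1β := sub_nonneg.2 hβ1
  refine (pi_norm_le_iff_of_nonneg (by positivity)).2 fun t => ?_
  have hcl := abs_clamp_le hd.le (x.1 t.castSucc m)
  rw [truncF, PiLp.norm_single, Real.norm_eq_abs]
  refine (hgrowth t t.2 _ (abs_le.1 hcl)).trans ?_
  gcongr
  exact (Real.rpow_le_rpow (abs_nonneg _) hcl hβ.le).trans hpow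

theorem inner_adjPsi_truncF (g : ℝ → ℝ → ℝ) (d : ℝ) (x : spaceX N B) (t : Fin N) :
    inner ℝ (adjPsi N a B w t) (truncF N B m g d x t) =
      psiLast N a B w t * g t (clamp d (x.1 t.castSucc m)) := by
  rw [truncF, EuclideanSpace.inner_single_right]
  simp [psiLast, mul_comm]

/-- The truncated bifurcation system has a solution. -/
theorem exists_clamped_fixedPoint {E : Type*} [NormedAddCommGroup E] [NormedSpace ℝ E]
    [FiniteDimensional ℝ E] {Z : Type*} [NormedAddCommGroup Z] [NormedSpace ℝ Z]
    (T : Z →L[ℝ] E) {F : E → Z} (hF : Continuous F) {C : ℝ} (hC : ∀ x, ‖F x‖ ≤ C)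
    {H : E → ℝ} (hH : Continuous H) {r : ℝ} (hr : 0 ≤ r) (s : E) :
    ∃ (α : ℝ) (z : E), |α| ≤ r ∧ z = T (F (α • s + z)) ∧ clamp r (α - H (α • s + z)) = α := by
  have hcl := continuous_clamp r
  let x : ℝ × E → E := fun p => clamp r p.1 • s + p.2
  have hx : Continuous x := by
    have : Continuous fun p : ℝ × E => clamp r p.1 := hcl.comp continuous_fst
    fun_prop
  -- The inner clamp of `α` keeps the argument of `H` consistent with that of `F`; at a fixed point
  -- `|α| ≤ r`, so it disappears.
  obtain ⟨⟨α, z⟩, h⟩ := exists_fixedPoint_of_continuous_bounded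
    (f := fun p : ℝ × E => (clamp r (clamp r p.1 - H (x p)), T (F (x p))))
    ((hcl.comp ((hcl.comp continuous_fst).sub (hH.comp hx))).prodMk
      (T.continuous.comp (hF.comp hx))) (R := max r (‖T‖ * C)) fun p =>
        max_le_max (abs_clamp_le hr _)
          ((T.le_opNorm _).trans (mul_le_mul_of_nonneg_left (hC _) (norm_nonneg _)))
  rw [Prod.mk.injEq] at h
  have hα : |α| ≤ r := by
    rw [← h.1]
    exact abs_clamp_le hr _
  simp only [x, clamp_eq_self hα] at h
  exact ⟨α, z, hα, h.2.symm, h.1⟩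

end NonlinearProblem

end MultipointBVP

end

/-! ### The existence theorem. -/

open MultipointBVP
theorem corollary3p4 {n : ℕ} [NeZero n] (N : ℕ) (hN : 2 < N)
    (a : ℕ → Fin n → ℝ) (ha : ∀ t < N, a t 0 ≠ 0)
    (B : ℕ → Matrix (Fin n) (Fin n) ℝ) (hB : IndependentBC N B)
    (m : Fin n)
    (g : ℝ → ℝ → ℝ) (hg : Continuous fun p : ℝ × ℝ => g p.1 p.2)
    (hres : Resonant N a B)
    (u w : EuclideanSpace ℝ (Fin n))
    (hu : IsBasisVector (matKer (bdryMat N a B)) u)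
    (hw : IsBasisVector (matKer (bdryMat N a B)ᵀ) w)
    -- `𝒪₀` is empty
    (hC1 : setZero N a B m u w = ∅)
    -- one-sided bounds for `g` on `[c, d]` and on `[-d, -c]`
    (c d : ℝ) (hc : 0 < c) (hcd : c < d)
    (W₁ U₁ W₂ U₂ w₁ u₁ w₂ u₂ : ℕ → ℝ)
    (hPP : ∀ t ∈ setPP N a B m u w,
      (∀ x ∈ Set.Icc c d, W₁ t < g t x) ∧ ∀ x ∈ Set.Icc (-d) (-c), g t x < U₁ t)
    (hPM : ∀ t ∈ setPM N a B m u w,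
      (∀ x ∈ Set.Icc c d, g t x < u₁ t) ∧ ∀ x ∈ Set.Icc (-d) (-c), w₁ t < g t x)
    (hMP : ∀ t ∈ setMP N a B m u w,
      (∀ x ∈ Set.Icc c d, g t x < W₂ t) ∧ ∀ x ∈ Set.Icc (-d) (-c), U₂ t < g t x)
    (hMM : ∀ t ∈ setMM N a B m u w,
      (∀ x ∈ Set.Icc c d, u₂ t < g t x) ∧ ∀ x ∈ Set.Icc (-d) (-c), g t x < w₂ t)
    -- `J₂ ≤ 0 ≤ J₁`
    (hJ₂ : psiSum N a B w (glue N a B m u w U₁ u₁ U₂ u₂) ≤ 0)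
    (hJ₁ : 0 ≤ psiSum N a B w (glue N a B m u w W₁ w₁ W₂ w₂))
    -- growth of `g` on `[-d, d]`
    (M₁ M₂ β : ℝ) (hM₁ : 0 < M₁) (hM₂ : 0 < M₂) (hβ : 0 < β) (hβ1 : β ≤ 1)
    (hgrowth : ∀ t < N, ∀ x ∈ Set.Icc (-d) d, |g t x| ≤ M₁ * |x| ^ β + M₂)
    -- with `K₁ = A M₁` and `K₂ = A M₂`, where `A` is the operator norm of `M_p (I - Q)`
    (K₁ K₂ : ℝ) (hK₁ : K₁ = ‖opMpIQ N a B w‖ * M₁) (hK₂ : K₂ = ‖opMpIQ N a B w‖ * M₂)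
    (hden : 0 < sMin N a B m u w - K₁ * β * (sMax N a m u + sMin N a B m u w))
    (hd : (c * sMax N a m u + (K₁ * (1 - β) + K₂) * (sMax N a m u + sMin N a B m u w)) /
      (sMin N a B m u w - K₁ * β * (sMax N a m u + sMin N a B m u w)) < d) :
    ∃ y : ℕ → ℝ, IsSolution N a B m g y := by
  have hd0 : 0 < d := hc.trans hcd
  have hA0 : 0 ≤ ‖opMpIQ N a B w‖ :=
    ContinuousLinearMap.opNorm_nonneg _
  have hsM : 0 ≤ sMax N a m u := sMax_nonneg
  have hsm0 : 0 ≤ sMin N a B m u w := sMin_nonneg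
  have hK₁0 : 0 ≤ K₁ := by rw [hK₁]; positivity
  have hK₂0 : 0 ≤ K₂ := by rw [hK₂]; positivity
  have hsm : 0 < sMin N a B m u w := by
    have : 0 ≤ K₁ * β * (sMax N a m u + sMin N a B m u w) := by positivity
    linarith
  -- The infimum of the empty set is `0` by convention, so `s_min > 0` already yields nonemptiness.
  have hO : (setO N a B m u w).Nonempty := by
    rw [Set.nonempty_iff_ne_empty]
    intro h
    rw [sMin, h, Set.image_empty, Real.sInf_empty] at hsm
    exact lt_irrefl _ hsm
  have hu' : u ∈ matKer (bdryMat N a B) := hu.2 ▸ Submodule.mem_span_singleton_self u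
  have h1β := sub_nonneg.2 hβ1
  set r := K₁ * β * d + K₁ * (1 - β) + K₂ with hr
  have hr0 : 0 ≤ r := by positivity
  -- The least amplitude for which `|α| = ρ` keeps `[x(t)]_m` at distance `c` from `0` on `𝒪`,
  -- whatever `z` with `‖z‖ ≤ r`.
  set ρ := (c + r) / sMin N a B m u w with hρ
  have hρ0 : 0 ≤ ρ := by positivity
  have hρm : ρ * sMin N a B m u w = c + r := div_mul_cancel₀ _ hsm.ne'
  -- After clearing denominators, this is the assumed lower bound on `d`, since `r` is affine in `d`
  -- with slope `K₁ β`.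
  have hρd : ρ * sMax N a m u + r ≤ d := by
    rw [div_lt_iff₀ hden] at hd
    rw [hρ, div_mul_eq_mul_div, div_add' _ _ _ hsm.ne', div_le_iff₀ hsm]
    rw [hr]
    linarith
  let s : spaceX N B := ⟨_, fundMat_mem_spaceX hu'⟩
  have hFn := norm_truncF_le (B := B) (m := m) hd0 hM₁ hM₂ hβ hβ1 hgrowth
  have hFc := continuous_truncF (N := N) (B := B) (m := m) hg d
  obtain ⟨α, z, hα, hz, hH⟩ := exists_clamped_fixedPoint (opMpIQ N a B w) hFc hFn
    (H := fun x => ∑ i : Fin N, inner ℝ (adjPsi N a B w i) (truncF N B m g d x i))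
    (by fun_prop) hρ0 s
  set x := α • s + z with hx
  have hzr : ∀ t : Fin (N + 1), |z.1 t m| ≤ r := fun t => by
    have h1 : ‖z‖ ≤ r := by
      rw [hz]
      refine ((opMpIQ N a B w).le_opNorm _).trans
        ((mul_le_mul_of_nonneg_left (hFn _) hA0).trans_eq ?_)
      rw [hr, hK₁, hK₂]
      ring
    exact ((PiLp.norm_apply_le (z.1 t) m).trans (norm_le_pi_norm z.1 t)).trans h1
  have hxt : ∀ t : Fin N, x.1 t.castSucc m = α * solS a u t m + z.1 t.castSucc m := fun t => rfl
  have hxd : ∀ t : Fin N, |x.1 t.castSucc m| ≤ d := fun t => by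
    rw [hxt]
    refine (abs_add_le _ _).trans ((add_le_add ?_ (hzr _)).trans hρd)
    rw [abs_mul]
    exact mul_le_mul hα (le_sMax t.2) (abs_nonneg _) hρ0
  simp only [inner_adjPsi_truncF, clamp_eq_self (hxd _)] at hH
  have hlarge : ∀ t : Fin N, (t : ℕ) ∈ setO N a B m u w →
      c + r ≤ ρ * |solS a u t m| := fun t ht =>
    hρm ▸ mul_le_mul_of_nonneg_left (sMin_le ht) hρ0
  have hsum : ∑ t : Fin N, psiLast N a B w t * g t (x.1 t.castSucc m) = 0 := by
    rcases lt_trichotomy (∑ t : Fin N, psiLast N a B w t * g t (x.1 t.castSucc m)) 0 with h | h | h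
    · exfalso
      -- At `α = ρ` the sign of `[x(t)]_m` on `𝒪` is that of `[S(t)]_m`, so the sum dominates `J₁`.
      have hαρ := eq_of_clamp_sub_eq hρ0 hH h
      refine not_le.2 h (hJ₁.trans ?_)
      rw [psiSum, Finset.sum_range]
      refine Finset.sum_le_sum fun t _ => ?_
      have hzt := abs_le.1 (hzr t.castSucc)
      have hxt' := abs_le.1 (hxd t)
      have ht' := hxt t
      rw [hαρ] at ht'
      have hp : (t : ℕ) ∈ setO N a B m u w → 0 < solS a u t m →
          x.1 t.castSucc m ∈ Set.Icc c d := fun hm hS => by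
        have := hlarge t hm
        rw [abs_of_pos hS] at this
        exact ⟨by linarith, hxt'.2⟩
      have hn : (t : ℕ) ∈ setO N a B m u w → solS a u t m < 0 →
          x.1 t.castSucc m ∈ Set.Icc (-d) (-c) := fun hm hS => by
        have := hlarge t hm
        rw [abs_of_neg hS] at this
        exact ⟨hxt'.1, by linarith⟩
      exact psiLast_mul_glue_le hC1 t.2
        (fun hm => ((hPP t hm).1 _ (hp (.inl (.inl (.inl hm))) hm.2.2)).le)
        (fun hm => ((hPM t hm).2 _ (hn (.inl (.inl (.inr hm))) hm.2.2)).le)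
        (fun hm => ((hMP t hm).1 _ (hp (.inl (.inr hm)) hm.2.2)).le)
        (fun hm => ((hMM t hm).2 _ (hn (.inr hm) hm.2.2)).le)
    · exact h
    · exfalso
      -- At `α = -ρ` the signs are swapped and the sum is at most `J₂`.
      have hαρ := eq_neg_of_clamp_sub_eq hH h
      refine not_le.2 h (le_trans ?_ hJ₂)
      rw [psiSum, Finset.sum_range]
      refine Finset.sum_le_sum fun t _ => ?_
      have hzt := abs_le.1 (hzr t.castSucc)
      have hxt' := abs_le.1 (hxd t)
      have ht' := hxt t
      rw [hαρ] at ht'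
      have hp : (t : ℕ) ∈ setO N a B m u w → 0 < solS a u t m →
          x.1 t.castSucc m ∈ Set.Icc (-d) (-c) := fun hm hS => by
        have := hlarge t hm
        rw [abs_of_pos hS] at this
        exact ⟨hxt'.1, by linarith⟩
      have hn : (t : ℕ) ∈ setO N a B m u w → solS a u t m < 0 →
          x.1 t.castSucc m ∈ Set.Icc c d := fun hm hS => by
        have := hlarge t hm
        rw [abs_of_neg hS] at this
        exact ⟨by linarith, hxt'.2⟩
      exact le_psiLast_mul_glue hC1 t.2
        (fun hm => ((hPP t hm).2 _ (hp (.inl (.inl (.inl hm))) hm.2.2)).le)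
        (fun hm => ((hPM t hm).1 _ (hn (.inl (.inl (.inr hm))) hm.2.2)).le)
        (fun hm => ((hMP t hm).2 _ (hp (.inl (.inr hm)) hm.2.2)).le)
        (fun hm => ((hMM t hm).1 _ (hn (.inr hm) hm.2.2)).le)
  have hQ : projQ N a B w (truncF N B m g d x) = 0 := by
    refine projQ_eq_zero ?_
    simpa only [inner_adjPsi_truncF, clamp_eq_self (hxd _)] using hsum
  have hL : opL N a B x = truncF N B m g d x := by
    have hs : opL N a B s = 0 := opL_fundMat hu'
    rw [hx, map_add, map_smul, hs, smul_zero, zero_add,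
      congrArg (opL N a B) hz, opL_opMpIQ ha hw.2 (sum_sq_norm_adjPsi_ne_zero hO), hQ, sub_zero]
  refine exists_isSolution_of_opL_eq x fun t => ?_
  rw [hL, truncF, clamp_eq_self (hxd t)]
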